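/- Let $X_1,\dots,X_N$ be i.i.d. real random variables with law $\nu$, mean $\mu$, variance $\sigma^2$ and finite fourth central moment $\sigma_4=E(X_i-\mu)^4$. Let $\overline X=N^{-1}\sum_{i=1}^N X_i$ and let $\mathrm{SE}^2=\operatorname{Var}(\overline X)$ $(=\sigma^2/N)$. The analytic-formula estimator of $\mathrm{SE}^2$ is $\widehat{\mathrm{SE}}{}^2_A=\hat\sigma^2/N$ with $\hat\sigma^2=N^{-1}\sum_{i=1}^N (X_i-\overline X)^2$. The Bag of Little Bootstraps (BLB) estimator with subset size $n\ge 1$, $R\ge 1$ subsets and $B\ge 1$ second-stage resamples per subset is defined as follows. For $1\le r\le R$ draw $X^{(r)}_1,\dots,X^{(r)}_n$ independently and uniformly, with replacement, from $\{X_1,\dots,X_N\}$, and for $1\le b\le B$ draw $X^{(r,b)}_1,\dots,X^{(r,b)}_N$ independently and uniformly, with replacement, from $\{X^{(r)}_1,\dots,X^{(r)}_n\}$; all the index draws are mutually independent and independent of the data. Put $\overline X^{(r)}=n^{-1}\sum_{i=1}^n X^{(r)}_i$, $\overline X^{(r,b)}=N^{-1}\sum_{i=1}^N X^{(r,b)}_i$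 and $$\widehat{\mathrm{SE}}{}^2_C=\frac1{BR}\sum_{r=1}^R\sum_{b=1}^B\bigl(\overline X^{(r,b)}-\overline X^{(r)}\bigr)^2 .$$ Let the law $\nu$ be fixed, let $N\to\infty$, and let $n,R,B\ge1$ vary with $N$ in an arbitrary way. Then $\overline X$, $\widehat{\mathrm{SE}}{}^2_A$ and $\widehat{\mathrm{SE}}{}^2_C$ are square integrable and $$E\bigl(\widehat{\mathrm{SE}}{}^2_C\bigr)=\frac{\sigma^2}{N}\Bigl(1-\frac1n\Bigr)\{1+o(1)\}.$$ If moreover $n\to\infty$ and $\sigma_4\ne\sigma^4$ (with no condition on $R,B\ge 1$), then $$\operatorname{Var}\bigl(\widehat{\mathrm{SE}}{}^2_C\bigr)=\operatorname{Var}\bigl(\widehat{\mathrm{SE}}{}^2_A\bigr)\Bigl(\frac{2\sigma^4}{\sigma_4-\sigma^4}\cdot\frac{N}{RB}+\frac{N}{nR}+1\Bigr)\{1+o(1)\},$$ and the mean squared error $\mathrm{MSE}=E\bigl(\widehat{\mathrm{SE}}{}^2_C-\mathrm{SE}^2\bigr)^2$ satisfies $$\mathrm{MSE}=\operatorname{Var}\bigl(\widehat{\mathrm{SE}}{}^2_A\bigr)\Bigl(\frac{2\sigma^4}{\sigma_4-\sigma^4}\cdot\frac{N}{RB}+\frac{N}{nR}+1\Bigr)\{1+o(1)\}+\frac{\sigma^4}{N^2n^2}$$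 and $$\mathrm{MSE}=\frac{\sigma_4-\sigma^4}{N^2}\Bigl(\frac{2\sigma^4}{\sigma_4-\sigma^4}\cdot\frac1{RB}+\frac1{nR}+\frac{\sigma^4}{\sigma_4-\sigma^4}\cdot\frac1{n^2}\Bigr)\{1+o(1)\}+\frac{\sigma_4-\sigma^4}{N^3}\{1+o(1)\}.$$ -/

import Mathlib

open MeasureTheory ProbabilityTheory Filter Topology Asymptotics

noncomputable section

namespace BLB

/-- The average `m⁻¹ ∑ xᵢ` of a finite data set. -/
def mean {m : ℕ} (x : Fin m → ℝ) : ℝ := (∑ i, x i) / m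

/-- The (biased) empirical variance `m⁻¹ ∑ (xᵢ - mean x)²` of a finite data set. -/
def empVar {m : ℕ} (x : Fin m → ℝ) : ℝ := (∑ i, (x i - mean x) ^ 2) / m

/-- The analytic-formula estimator of the squared standard error of the sample mean:
the empirical variance divided by the sample size. -/
def seSqA {N : ℕ} (x : Fin N → ℝ) : ℝ := empVar x / N

/-- The `r`-th little subset: its `i`-th element is the data point drawn with index `I r i`. -/
def subset {N n R : ℕ} (x : Fin N → ℝ) (I : Fin R → Fin n → Fin N) (r : Fin R) : Fin n → ℝ :=
  fun i => x (I r i)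

/-- The `b`-th second-stage resample, of the full size `N`, from the `r`-th little subset. -/
def resample {N n R B : ℕ} (x : Fin N → ℝ) (I : Fin R → Fin n → Fin N)
    (J : Fin R → Fin B → Fin N → Fin n) (r : Fin R) (b : Fin B) : Fin N → ℝ :=
  fun i => subset x I r (J r b i)

/-- The Bag of Little Bootstraps estimator of the squared standard error of the sample mean. -/
def seSqC {N n R B : ℕ} (x : Fin N → ℝ) (I : Fin R → Fin n → Fin N)
    (J : Fin R → Fin B → Fin N → Fin n) : ℝ :=
  (∑ r, ∑ b, (mean (resample x I J r b) - mean (subset x I r)) ^ 2) / (B * R)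

/-- The joint law of the data and of all the index draws of the two sampling stages:
`N` data points with law `ν`, first-stage indices uniform on `Fin N` and second-stage indices
uniform on `Fin n` (simple random sampling with replacement), everything mutually independent. -/
def law (ν : Measure ℝ) (N n R B : ℕ) :
    Measure ((Fin N → ℝ) × (Fin R → Fin n → Fin N) × (Fin R → Fin B → Fin N → Fin n)) :=
  (Measure.pi fun _ => ν).prod
    ((Measure.pi fun _ => Measure.pi fun _ => uniformOn Set.univ).prod
      (Measure.pi fun _ => Measure.pi fun _ => Measure.pi fun _ => uniformOn Set.univ))

/-- The mean squared error of the estimator `T` of the number `θ`. -/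
def mse {Ω : Type*} [MeasurableSpace Ω] (P : Measure Ω) (T : Ω → ℝ) (θ : ℝ) : ℝ :=
  ∫ ω, (T ω - θ) ^ 2 ∂P

end BLB

end

noncomputable section

namespace BLB

/-- `F` is integrable with integral `c`. -/
def HasExpect {β : Type*} [MeasurableSpace β] (P : Measure β) (F : β → ℝ) (c : ℝ) : Prop :=
  Integrable F P ∧ ∫ x, F x ∂P = c

section HasExpect

variable {β γ : Type*} [MeasurableSpace β] [MeasurableSpace γ] {P : Measure β} {Q : Measure γ}
  {F G : β → ℝ} {c d : ℝ}

lemma HasExpect.add (hF : HasExpect P F c) (hG : HasExpect P G d) :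
    HasExpect P (fun x => F x + G x) (c + d) :=
  ⟨hF.1.add hG.1, by rw [integral_add hF.1 hG.1, hF.2, hG.2]⟩

lemma HasExpect.const_mul (a : ℝ) (hF : HasExpect P F c) :
    HasExpect P (fun x => a * F x) (a * c) :=
  ⟨hF.1.const_mul a, by rw [integral_const_mul, hF.2]⟩

lemma HasExpect.congr (hF : HasExpect P F c) (hFG : ∀ x, G x = F x) (hcd : d = c) :
    HasExpect P G d := by
  obtain rfl : G = F := funext hFG
  rwa [hcd]

lemma hasExpect_const [IsProbabilityMeasure P] (c : ℝ) : HasExpect P (fun _ => c) c :=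
  ⟨integrable_const c, by simp⟩

lemma HasExpect.mul_prod [SFinite P] [SFinite Q] {H : γ → ℝ}
    (hF : HasExpect P F c) (hH : HasExpect Q H d) :
    HasExpect (P.prod Q) (fun p => F p.1 * H p.2) (c * d) :=
  ⟨hF.1.mul_prod hH.1, by rw [integral_prod_mul, hF.2, hH.2]⟩

end HasExpect

section PowerSum

variable {α : Type*}

/-- The power sum `∑ g(zᵢ)ᵏ`. -/
def powerSum (g : α → ℝ) (k : ℕ) {m : ℕ} (z : Fin m → α) : ℝ := ∑ i, g (z i) ^ k

lemma powerSum_cons (g : α → ℝ) (k : ℕ) {m : ℕ} (a : α) (z : Fin m → α) :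
    powerSum g k (Fin.cons a z : Fin (m + 1) → α) = g a ^ k + powerSum g k z := by
  simp [powerSum, Fin.sum_univ_succ]

lemma powerSum_zero (g : α → ℝ) (k : ℕ) (z : Fin 0 → α) : powerSum g k z = 0 := by
  simp [powerSum]

variable [MeasurableSpace α] {ρ : Measure α} [IsProbabilityMeasure ρ]

lemma coe_piFinSuccAbove_symm (α : Type*) [MeasurableSpace α] (m : ℕ) :
    ⇑(MeasurableEquiv.piFinSuccAbove (fun _ : Fin (m + 1) => α) 0).symm =
      fun p : α × (Fin m → α) => (Fin.cons p.1 p.2 : Fin (m + 1) → α) := by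
  ext p i
  simp [MeasurableEquiv.piFinSuccAbove]

lemma HasExpect.of_cons {m : ℕ} {F : (Fin (m + 1) → α) → ℝ} {c : ℝ}
    (h : HasExpect (ρ.prod (Measure.pi fun _ : Fin m => ρ)) (fun p => F (Fin.cons p.1 p.2)) c) :
    HasExpect (Measure.pi fun _ => ρ) F c := by
  have hp := (measurePreserving_piFinSuccAbove (fun _ : Fin (m + 1) => ρ) 0).symm
  have he := (MeasurableEquiv.piFinSuccAbove (fun _ : Fin (m + 1) => α) 0).symm.measurableEmbedding
  rw [coe_piFinSuccAbove_symm] at hp he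
  exact ⟨(hp.integrable_comp_emb he).1 h.1, (hp.integral_comp he F).symm.trans h.2⟩

/-- The random variable `g` is centered and has the finite moments `a₂`, `a₃`, `a₄`. -/
structure CenteredMoments (ρ : Measure α) (g : α → ℝ) (a₂ a₃ a₄ : ℝ) : Prop where
  one : HasExpect ρ (fun x => g x) 0
  two : HasExpect ρ (fun x => g x ^ 2) a₂
  three : HasExpect ρ (fun x => g x ^ 3) a₃
  four : HasExpect ρ (fun x => g x ^ 4) a₄

variable {g : α → ℝ} {a₂ a₃ a₄ : ℝ}

lemma hasExpect_powerSum {k : ℕ} {a : ℝ} (h : HasExpect ρ (fun x => g x ^ k) a) (m : ℕ) :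
    HasExpect (Measure.pi fun _ : Fin m => ρ) (powerSum g k) (m * a) := by
  induction m with
  | zero => exact (hasExpect_const 0).congr (powerSum_zero g k) (by simp)
  | succ m ih =>
    refine HasExpect.of_cons (((h.mul_prod (hasExpect_const 1)).add
      ((hasExpect_const 1).mul_prod ih)).congr (fun p => ?_) ?_)
    · simp only [powerSum_cons]; ring
    · push_cast; ring

namespace CenteredMoments

lemma powerSum_one (h : CenteredMoments ρ g a₂ a₃ a₄) (m : ℕ) :
    HasExpect (Measure.pi fun _ : Fin m => ρ) (powerSum g 1) 0 :=
  (hasExpect_powerSum (a := 0) (by simpa using h.one) m).congr (fun _ => rfl) (by simp)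

lemma powerSum_one_sq (h : CenteredMoments ρ g a₂ a₃ a₄) (m : ℕ) :
    HasExpect (Measure.pi fun _ : Fin m => ρ) (fun z => powerSum g 1 z ^ 2) (m * a₂) := by
  induction m with
  | zero => exact (hasExpect_const 0).congr (fun z => by simp [powerSum_zero]) (by simp)
  | succ m ih =>
    refine HasExpect.of_cons (((h.two.mul_prod (hasExpect_const 1)).add
      (((h.one.mul_prod (h.powerSum_one m)).const_mul 2).add
      ((hasExpect_const 1).mul_prod ih))).congr (fun p => ?_) ?_)
    · simp only [powerSum_cons]; ring
    · push_cast; ring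

lemma powerSum_one_cube (h : CenteredMoments ρ g a₂ a₃ a₄) (m : ℕ) :
    HasExpect (Measure.pi fun _ : Fin m => ρ) (fun z => powerSum g 1 z ^ 3) (m * a₃) := by
  induction m with
  | zero => exact (hasExpect_const 0).congr (fun z => by simp [powerSum_zero]) (by simp)
  | succ m ih =>
    refine HasExpect.of_cons (((h.three.mul_prod (hasExpect_const 1)).add
      (((h.two.mul_prod (h.powerSum_one m)).const_mul 3).add
      (((h.one.mul_prod (h.powerSum_one_sq m)).const_mul 3).add
      ((hasExpect_const 1).mul_prod ih)))).congr (fun p => ?_) ?_)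
    · simp only [powerSum_cons]; ring
    · push_cast; ring

lemma powerSum_one_pow_four (h : CenteredMoments ρ g a₂ a₃ a₄) (m : ℕ) :
    HasExpect (Measure.pi fun _ : Fin m => ρ) (fun z => powerSum g 1 z ^ 4)
      (m * a₄ + 3 * m * (m - 1) * a₂ ^ 2) := by
  induction m with
  | zero => exact (hasExpect_const 0).congr (fun z => by simp [powerSum_zero]) (by simp)
  | succ m ih =>
    refine HasExpect.of_cons (((h.four.mul_prod (hasExpect_const 1)).add
      (((h.three.mul_prod (h.powerSum_one m)).const_mul 4).add
      (((h.two.mul_prod (h.powerSum_one_sq m)).const_mul 6).add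
      (((h.one.mul_prod (h.powerSum_one_cube m)).const_mul 4).add
      ((hasExpect_const 1).mul_prod ih))))).congr (fun p => ?_) ?_)
    · simp only [powerSum_cons]; ring
    · push_cast; ring

lemma powerSum_two_mul_one (h : CenteredMoments ρ g a₂ a₃ a₄) (m : ℕ) :
    HasExpect (Measure.pi fun _ : Fin m => ρ) (fun z => powerSum g 2 z * powerSum g 1 z)
      (m * a₃) := by
  induction m with
  | zero => exact (hasExpect_const 0).congr (fun z => by simp [powerSum_zero]) (by simp)
  | succ m ih =>
    refine HasExpect.of_cons (((h.three.mul_prod (hasExpect_const 1)).add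
      ((h.two.mul_prod (h.powerSum_one m)).add
      ((h.one.mul_prod (hasExpect_powerSum h.two m)).add
      ((hasExpect_const 1).mul_prod ih)))).congr (fun p => ?_) ?_)
    · simp only [powerSum_cons]; ring
    · push_cast; ring

lemma powerSum_two_sq (h : CenteredMoments ρ g a₂ a₃ a₄) (m : ℕ) :
    HasExpect (Measure.pi fun _ : Fin m => ρ) (fun z => powerSum g 2 z ^ 2)
      (m * a₄ + m * (m - 1) * a₂ ^ 2) := by
  induction m with
  | zero => exact (hasExpect_const 0).congr (fun z => by simp [powerSum_zero]) (by simp)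
  | succ m ih =>
    refine HasExpect.of_cons (((h.four.mul_prod (hasExpect_const 1)).add
      (((h.two.mul_prod (hasExpect_powerSum h.two m)).const_mul 2).add
      ((hasExpect_const 1).mul_prod ih))).congr (fun p => ?_) ?_)
    · simp only [powerSum_cons]; ring
    · push_cast; ring

lemma powerSum_two_mul_one_sq (h : CenteredMoments ρ g a₂ a₃ a₄) (m : ℕ) :
    HasExpect (Measure.pi fun _ : Fin m => ρ) (fun z => powerSum g 2 z * powerSum g 1 z ^ 2)
      (m * a₄ + m * (m - 1) * a₂ ^ 2) := by
  induction m with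
  | zero => exact (hasExpect_const 0).congr (fun z => by simp [powerSum_zero]) (by simp)
  | succ m ih =>
    refine HasExpect.of_cons (((h.four.mul_prod (hasExpect_const 1)).add
      (((h.three.mul_prod (h.powerSum_one m)).const_mul 2).add
      ((h.two.mul_prod (h.powerSum_one_sq m)).add
      ((h.two.mul_prod (hasExpect_powerSum h.two m)).add
      (((h.one.mul_prod (h.powerSum_two_mul_one m)).const_mul 2).add
      ((hasExpect_const 1).mul_prod ih)))))).congr (fun p => ?_) ?_)
    · simp only [powerSum_cons]; ring
    · push_cast; ring

lemma powerSum_three_mul_one (h : CenteredMoments ρ g a₂ a₃ a₄) (m : ℕ) :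
    HasExpect (Measure.pi fun _ : Fin m => ρ) (fun z => powerSum g 3 z * powerSum g 1 z)
      (m * a₄) := by
  induction m with
  | zero => exact (hasExpect_const 0).congr (fun z => by simp [powerSum_zero]) (by simp)
  | succ m ih =>
    refine HasExpect.of_cons (((h.four.mul_prod (hasExpect_const 1)).add
      ((h.three.mul_prod (h.powerSum_one m)).add
      ((h.one.mul_prod (hasExpect_powerSum h.three m)).add
      ((hasExpect_const 1).mul_prod ih)))).congr (fun p => ?_) ?_)
    · simp only [powerSum_cons]; ring
    · push_cast; ring

end CenteredMoments

end PowerSum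

section SampleMoments

/-- The empirical fourth central moment of a finite data set. -/
def empFourth {m : ℕ} (x : Fin m → ℝ) : ℝ := (∑ i, (x i - mean x) ^ 4) / m

lemma mean_sub_const {m : ℕ} (hm : 0 < m) (x : Fin m → ℝ) (c : ℝ) :
    mean (fun i => x i - c) = mean x - c := by
  have : (m : ℝ) ≠ 0 := by positivity
  simp only [mean, Finset.sum_sub_distrib, Finset.sum_const, Finset.card_univ, Fintype.card_fin,
    nsmul_eq_mul]
  field_simp

lemma empVar_sub_const {m : ℕ} (hm : 0 < m) (x : Fin m → ℝ) (c : ℝ) :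
    empVar (fun i => x i - c) = empVar x := by
  simp [empVar, mean_sub_const hm]

lemma empFourth_sub_const {m : ℕ} (hm : 0 < m) (x : Fin m → ℝ) (c : ℝ) :
    empFourth (fun i => x i - c) = empFourth x := by
  simp [empFourth, mean_sub_const hm]

variable {α : Type*}

lemma mean_comp (g : α → ℝ) {m : ℕ} (z : Fin m → α) :
    mean (fun i => g (z i)) = powerSum g 1 z / m := by
  simp [mean, powerSum]

lemma empVar_comp (g : α → ℝ) {m : ℕ} (hm : 0 < m) (z : Fin m → α) :
    empVar (fun i => g (z i)) = powerSum g 2 z / m - powerSum g 1 z ^ 2 / m ^ 2 := by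
  have hm' : (m : ℝ) ≠ 0 := by positivity
  have h : ∑ i, (g (z i) - powerSum g 1 z / m) ^ 2 =
      powerSum g 2 z - 2 * (powerSum g 1 z / m) * powerSum g 1 z
        + m * (powerSum g 1 z / m) ^ 2 := by
    generalize hs : powerSum g 1 z / m = s
    simp only [powerSum, Finset.mul_sum, ← Finset.sum_sub_distrib]
    rw [show (m : ℝ) * s ^ 2 = ∑ _i : Fin m, s ^ 2 by simp, ← Finset.sum_add_distrib]
    exact Finset.sum_congr rfl fun i _ => by ring
  rw [empVar, mean_comp, h]
  field_simp
  ring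

lemma empFourth_comp (g : α → ℝ) {m : ℕ} (hm : 0 < m) (z : Fin m → α) :
    empFourth (fun i => g (z i)) = powerSum g 4 z / m
      - 4 / m ^ 2 * (powerSum g 3 z * powerSum g 1 z)
      + 6 / m ^ 3 * (powerSum g 2 z * powerSum g 1 z ^ 2)
      - 3 / m ^ 4 * powerSum g 1 z ^ 4 := by
  have hm' : (m : ℝ) ≠ 0 := by positivity
  have h : ∑ i, (g (z i) - powerSum g 1 z / m) ^ 4 =
      powerSum g 4 z - 4 * (powerSum g 1 z / m) * powerSum g 3 z
        + 6 * (powerSum g 1 z / m) ^ 2 * powerSum g 2 z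
        - 4 * (powerSum g 1 z / m) ^ 3 * powerSum g 1 z
        + m * (powerSum g 1 z / m) ^ 4 := by
    generalize hs : powerSum g 1 z / m = s
    simp only [powerSum, Finset.mul_sum, ← Finset.sum_sub_distrib, ← Finset.sum_add_distrib]
    rw [show (m : ℝ) * s ^ 4 = ∑ _i : Fin m, s ^ 4 by simp, ← Finset.sum_add_distrib]
    exact Finset.sum_congr rfl fun i _ => by ring
  rw [empFourth, mean_comp, h]
  field_simp
  ring

/-- The weight of the fourth moment in the second moment of the empirical variance. -/
def sqW₄ (m : ℝ) : ℝ := (m - 1) ^ 2 / m ^ 3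

/-- The weight of the squared variance in the second moment of the empirical variance. -/
def sqW₂ (m : ℝ) : ℝ := (m - 1) * (m ^ 2 - 2 * m + 3) / m ^ 3

/-- The weight of the fourth moment in the mean of the empirical fourth moment. -/
def fourthW₄ (m : ℝ) : ℝ := 1 - 4 / m + 6 / m ^ 2 - 3 / m ^ 3

/-- The weight of the squared variance in the mean of the empirical fourth moment. -/
def fourthW₂ (m : ℝ) : ℝ := 6 * (m - 1) / m ^ 2 - 9 * (m - 1) / m ^ 3

variable [MeasurableSpace α] {ρ : Measure α} [IsProbabilityMeasure ρ]
  {f : α → ℝ} {c a₂ a₃ a₄ : ℝ}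

lemma hasExpect_mean_sub_sq (h : CenteredMoments ρ (fun x => f x - c) a₂ a₃ a₄)
    {m : ℕ} (hm : 0 < m) :
    HasExpect (Measure.pi fun _ : Fin m => ρ) (fun z => (mean (fun i => f (z i)) - c) ^ 2)
      (a₂ / m) := by
  have hm' : (m : ℝ) ≠ 0 := by positivity
  refine ((h.powerSum_one_sq m).const_mul (1 / m ^ 2)).congr (fun z => ?_) ?_
  · rw [← mean_sub_const hm, mean_comp (fun x => f x - c)]; ring
  · field_simp

lemma hasExpect_mean_sub (h : CenteredMoments ρ (fun x => f x - c) a₂ a₃ a₄)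
    {m : ℕ} (hm : 0 < m) :
    HasExpect (Measure.pi fun _ : Fin m => ρ) (fun z => mean (fun i => f (z i)) - c) 0 := by
  refine ((h.powerSum_one m).const_mul (1 / m)).congr (fun z => ?_) (by simp)
  rw [← mean_sub_const hm, mean_comp (fun x => f x - c)]; ring

lemma hasExpect_mean_sub_pow_four (h : CenteredMoments ρ (fun x => f x - c) a₂ a₃ a₄)
    {m : ℕ} (hm : 0 < m) :
    HasExpect (Measure.pi fun _ : Fin m => ρ) (fun z => (mean (fun i => f (z i)) - c) ^ 4)
      ((a₄ + 3 * (m - 1) * a₂ ^ 2) / m ^ 3) := by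
  have hm' : (m : ℝ) ≠ 0 := by positivity
  refine ((h.powerSum_one_pow_four m).const_mul (1 / m ^ 4)).congr (fun z => ?_) ?_
  · rw [← mean_sub_const hm, mean_comp (fun x => f x - c)]; ring
  · field_simp

lemma hasExpect_empVar (h : CenteredMoments ρ (fun x => f x - c) a₂ a₃ a₄)
    {m : ℕ} (hm : 0 < m) :
    HasExpect (Measure.pi fun _ : Fin m => ρ) (fun z => empVar (fun i => f (z i)))
      ((1 - 1 / m) * a₂) := by
  have hm' : (m : ℝ) ≠ 0 := by positivity
  refine (((hasExpect_powerSum h.two m).const_mul (1 / m)).add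
    ((h.powerSum_one_sq m).const_mul (-(1 / m ^ 2)))).congr (fun z => ?_) ?_
  · rw [← empVar_sub_const hm _ c, empVar_comp (fun x => f x - c) hm]; ring
  · field_simp; ring

lemma hasExpect_empVar_sq (h : CenteredMoments ρ (fun x => f x - c) a₂ a₃ a₄)
    {m : ℕ} (hm : 0 < m) :
    HasExpect (Measure.pi fun _ : Fin m => ρ) (fun z => empVar (fun i => f (z i)) ^ 2)
      (sqW₄ m * a₄ + sqW₂ m * a₂ ^ 2) := by
  have hm' : (m : ℝ) ≠ 0 := by positivity
  refine (((h.powerSum_two_sq m).const_mul (1 / m ^ 2)).add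
    (((h.powerSum_two_mul_one_sq m).const_mul (-(2 / m ^ 3))).add
    ((h.powerSum_one_pow_four m).const_mul (1 / m ^ 4)))).congr (fun z => ?_) ?_
  · rw [← empVar_sub_const hm _ c, empVar_comp (fun x => f x - c) hm]; ring
  · simp only [sqW₄, sqW₂]; field_simp; ring

lemma hasExpect_empFourth (h : CenteredMoments ρ (fun x => f x - c) a₂ a₃ a₄)
    {m : ℕ} (hm : 0 < m) :
    HasExpect (Measure.pi fun _ : Fin m => ρ) (fun z => empFourth (fun i => f (z i)))
      (fourthW₄ m * a₄ + fourthW₂ m * a₂ ^ 2) := by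
  have hm' : (m : ℝ) ≠ 0 := by positivity
  refine (((hasExpect_powerSum h.four m).const_mul (1 / m)).add
    (((h.powerSum_three_mul_one m).const_mul (-(4 / m ^ 2))).add
    (((h.powerSum_two_mul_one_sq m).const_mul (6 / m ^ 3)).add
    ((h.powerSum_one_pow_four m).const_mul (-(3 / m ^ 4)))))).congr (fun z => ?_) ?_
  · rw [← empFourth_sub_const hm _ c, empFourth_comp (fun x => f x - c) hm]; ring
  · simp only [fourthW₄, fourthW₂]; field_simp; ring

end SampleMoments

section Averages

lemma integral_uniformOn_univ {m : ℕ} (hm : 0 < m) (f : Fin m → ℝ) :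
    ∫ i, f i ∂(uniformOn Set.univ) = (∑ i, f i) / m := by
  have : NeZero m := ⟨hm.ne'⟩
  have : IsProbabilityMeasure (uniformOn (Set.univ : Set (Fin m))) :=
    isProbabilityMeasure_uniformOn Set.finite_univ Set.univ_nonempty
  rw [integral_fintype Integrable.of_finite, Finset.sum_div]
  refine Finset.sum_congr rfl fun i _ => ?_
  rw [measureReal_def, uniformOn_univ]
  simp
  ring

lemma isProbabilityMeasure_uniformOn_fin {m : ℕ} (hm : 0 < m) :
    IsProbabilityMeasure (uniformOn (Set.univ : Set (Fin m))) :=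
  have : NeZero m := ⟨hm.ne'⟩
  isProbabilityMeasure_uniformOn Set.finite_univ Set.univ_nonempty

lemma centeredMoments_uniformOn {m : ℕ} (hm : 0 < m) (x : Fin m → ℝ) :
    CenteredMoments (uniformOn (Set.univ : Set (Fin m))) (fun i => x i - mean x)
      (empVar x) ((∑ i, (x i - mean x) ^ 3) / m) (empFourth x) := by
  have := isProbabilityMeasure_uniformOn_fin hm
  refine ⟨⟨.of_finite, ?_⟩, ⟨.of_finite, ?_⟩, ⟨.of_finite, ?_⟩, ⟨.of_finite, ?_⟩⟩
  · rw [integral_uniformOn_univ hm]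
    exact (mean_sub_const hm x (mean x)).trans (sub_self _)
  all_goals exact integral_uniformOn_univ hm _

lemma centeredMoments_of_memLp {ν : Measure ℝ} [IsProbabilityMeasure ν]
    (hν : MemLp (fun x : ℝ => x) 4 ν) {μ a₂ a₄ : ℝ} (hμ : μ = ∫ x, x ∂ν)
    (h₂ : a₂ = ∫ x, (x - μ) ^ 2 ∂ν) (h₄ : a₄ = ∫ x, (x - μ) ^ 4 ∂ν) :
    CenteredMoments ν (fun x => x - μ) a₂ (∫ x, (x - μ) ^ 3 ∂ν) a₄ := by
  have h : MemLp (fun x : ℝ => x - μ) 4 ν := hν.sub (memLp_const μ)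
  have hk : ∀ k : ℕ, k ≤ 4 → Integrable (fun x : ℝ => (x - μ) ^ k) ν := by
    intro k hk
    have := (h.mono_exponent (p := (k : ENNReal)) (by exact_mod_cast hk)).integrable_norm_pow'
    refine this.mono' (by fun_prop) (ae_of_all _ fun x => ?_)
    simp
  refine ⟨⟨by simpa using hk 1 (by norm_num), ?_⟩, ⟨hk 2 (by norm_num), h₂.symm⟩,
    ⟨hk 3 (by norm_num), rfl⟩, ⟨hk 4 le_rfl, h₄.symm⟩⟩
  rw [integral_sub (hν.integrable (by norm_num)) (integrable_const μ), ← hμ]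
  simp

end Averages

section FiniteSums

variable {β : Type*} [Finite β] [MeasurableSpace β] [DiscreteMeasurableSpace β]
  (ρ : Measure β) [IsProbabilityMeasure ρ]

lemma integral_sum_eval {m : ℕ} (f : Fin m → β → ℝ) :
    ∫ z, ∑ i, f i (z i) ∂(Measure.pi fun _ : Fin m => ρ) = ∑ i, ∫ y, f i y ∂ρ := by
  rw [integral_finsetSum _ fun i _ => Integrable.of_finite]
  exact Finset.sum_congr rfl fun i _ =>
    integral_comp_eval (μ := fun _ : Fin m => ρ) (Measurable.of_discrete.aestronglyMeasurable)

lemma integral_sum_eval_sq {m : ℕ} (f : Fin m → β → ℝ) :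
    ∫ z, (∑ i, f i (z i)) ^ 2 ∂(Measure.pi fun _ : Fin m => ρ) =
      ∑ i, (∫ y, f i y ^ 2 ∂ρ - (∫ y, f i y ∂ρ) ^ 2) + (∑ i, ∫ y, f i y ∂ρ) ^ 2 := by
  have h := variance_sum_pi (μ := fun _ : Fin m => ρ) (X := f) fun _ => MemLp.of_discrete
  rw [variance_eq_sub MemLp.of_discrete] at h
  simp only [Pi.pow_apply, Finset.sum_apply] at h
  rw [integral_sum_eval ρ f, sub_eq_iff_eq_add] at h
  rw [h]
  congr 1
  exact Finset.sum_congr rfl fun i _ => variance_eq_sub MemLp.of_discrete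

end FiniteSums

section Conditional

/-- The conditional variance of a single squared deviation of a second-stage mean, of `N` draws
from the data set `s`. -/
def resampleVar (N : ℕ) {n : ℕ} (s : Fin n → ℝ) : ℝ :=
  (empFourth s + (2 * N - 3) * empVar s ^ 2) / N ^ 3

/-- The law of the second-stage indices belonging to one subset. -/
abbrev resampleLaw (N n B : ℕ) : Measure (Fin B → Fin N → Fin n) :=
  Measure.pi fun _ => Measure.pi fun _ => uniformOn Set.univ

/-- The law of the indices of one subset. -/
abbrev subsetLaw (N n : ℕ) : Measure (Fin n → Fin N) := Measure.pi fun _ => uniformOn Set.univ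

lemma isProbabilityMeasure_resampleLaw (N : ℕ) {n : ℕ} (hn : 0 < n) (B : ℕ) :
    IsProbabilityMeasure (resampleLaw N n B) := by
  have := isProbabilityMeasure_uniformOn_fin hn
  infer_instance

lemma isProbabilityMeasure_subsetLaw {N : ℕ} (hN : 0 < N) (n : ℕ) :
    IsProbabilityMeasure (subsetLaw N n) := by
  have := isProbabilityMeasure_uniformOn_fin hN
  infer_instance

variable {N n R B : ℕ}

lemma integral_resample (hN : 0 < N) (hn : 0 < n) (B : ℕ) (s : Fin n → ℝ) :
    ∫ j, ∑ b, (mean (fun i => s (j b i)) - mean s) ^ 2 ∂(resampleLaw N n B) =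
      B * (empVar s / N) := by
  have := isProbabilityMeasure_uniformOn_fin hn
  rw [integral_sum_eval (Measure.pi fun _ => uniformOn Set.univ)
    fun _ k => (mean (fun i : Fin N => s (k i)) - mean s) ^ 2,
    (hasExpect_mean_sub_sq (centeredMoments_uniformOn hn s) hN).2]
  simp

lemma integral_resample_sq (hN : 0 < N) (hn : 0 < n) (B : ℕ) (s : Fin n → ℝ) :
    ∫ j, (∑ b, (mean (fun i => s (j b i)) - mean s) ^ 2) ^ 2 ∂(resampleLaw N n B) =
      B * resampleVar N s + (B * (empVar s / N)) ^ 2 := by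
  have := isProbabilityMeasure_uniformOn_fin hn
  have hN' : (N : ℝ) ≠ 0 := by positivity
  have h4 := (hasExpect_mean_sub_pow_four (centeredMoments_uniformOn hn s) hN).2
  have h : ∀ k : Fin N → Fin n, ((mean (fun i => s (k i)) - mean s) ^ 2) ^ 2 =
    (mean (fun i => s (k i)) - mean s) ^ 4 := fun k => by ring
  rw [integral_sum_eval_sq (Measure.pi fun _ => uniformOn Set.univ)
    fun _ k => (mean (fun i : Fin N => s (k i)) - mean s) ^ 2]
  simp only [h]
  rw [(hasExpect_mean_sub_sq (centeredMoments_uniformOn hn s) hN).2, h4]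
  simp only [Finset.sum_const, Finset.card_univ, Fintype.card_fin, nsmul_eq_mul, resampleVar]
  field_simp
  ring

lemma seSqC_eq (x : Fin N → ℝ) (I : Fin R → Fin n → Fin N) (J : Fin R → Fin B → Fin N → Fin n) :
    seSqC x I J = (∑ r, ∑ b, (mean (fun i => subset x I r (J r b i)) - mean (subset x I r)) ^ 2)
      / (B * R) := rfl

lemma subset_eq (x : Fin N → ℝ) (I : Fin R → Fin n → Fin N) (r : Fin R) :
    subset x I r = fun i => x (I r i) := rfl

lemma integral_seSqC_resample (hN : 0 < N) (hn : 0 < n) (hB : 0 < B)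
    (x : Fin N → ℝ) (I : Fin R → Fin n → Fin N) :
    ∫ J, seSqC x I J ∂(Measure.pi fun _ : Fin R => resampleLaw N n B) =
      (∑ r, empVar (subset x I r)) / (N * R) := by
  have := isProbabilityMeasure_resampleLaw N hn B
  have hB' : (B : ℝ) ≠ 0 := by positivity
  simp only [seSqC_eq]
  rw [integral_div, integral_sum_eval (resampleLaw N n B)
    fun r j => ∑ b, (mean (fun i => subset x I r (j b i)) - mean (subset x I r)) ^ 2]
  simp only [integral_resample hN hn, ← Finset.mul_sum, ← Finset.sum_div]
  field_simp

lemma integral_seSqC_sq_resample (hN : 0 < N) (hn : 0 < n) (hB : 0 < B)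
    (x : Fin N → ℝ) (I : Fin R → Fin n → Fin N) :
    ∫ J, seSqC x I J ^ 2 ∂(Measure.pi fun _ : Fin R => resampleLaw N n B) =
      1 / (B * R ^ 2) * ∑ r, resampleVar N (subset x I r) +
        1 / (N * R) ^ 2 * (∑ r, empVar (subset x I r)) ^ 2 := by
  have := isProbabilityMeasure_resampleLaw N hn B
  have hB' : (B : ℝ) ≠ 0 := by positivity
  simp only [seSqC_eq, div_pow]
  rw [integral_div, integral_sum_eval_sq (resampleLaw N n B)
    fun r j => ∑ b, (mean (fun i => subset x I r (j b i)) - mean (subset x I r)) ^ 2]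
  simp only [integral_resample hN hn, integral_resample_sq hN hn, add_sub_cancel_right,
    ← Finset.mul_sum, ← Finset.sum_div]
  field_simp

/-- The conditional mean of `resampleVar` given the data, in terms of the fourth empirical central
moment `M₄` of the data and the square `V` of its empirical variance. -/
def meanResampleVar (N n : ℕ) (M₄ V : ℝ) : ℝ :=
  (fourthW₄ n * M₄ + fourthW₂ n * V + (2 * N - 3) * (sqW₄ n * M₄ + sqW₂ n * V)) / N ^ 3

/-- The conditional second moment of the estimator given the data, in terms of the fourth empirical
central moment `M₄` of the data and the square `V` of its empirical variance. -/
def condSecondMoment (N n R B : ℕ) (M₄ V : ℝ) : ℝ :=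
  1 / (B * R) * meanResampleVar N n M₄ V +
    1 / N ^ 2 * ((sqW₄ n * M₄ + sqW₂ n * V - (1 - 1 / n) ^ 2 * V) / R + (1 - 1 / n) ^ 2 * V)

lemma integral_empVar_subset (hN : 0 < N) (hn : 0 < n) (x : Fin N → ℝ) :
    ∫ k, empVar (fun i => x (k i)) ∂(subsetLaw N n) = (1 - 1 / n) * empVar x :=
  have := isProbabilityMeasure_uniformOn_fin hN
  (hasExpect_empVar (centeredMoments_uniformOn hN x) hn).2

lemma integral_empVar_sq_subset (hN : 0 < N) (hn : 0 < n) (x : Fin N → ℝ) :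
    ∫ k, empVar (fun i => x (k i)) ^ 2 ∂(subsetLaw N n) =
      sqW₄ n * empFourth x + sqW₂ n * empVar x ^ 2 :=
  have := isProbabilityMeasure_uniformOn_fin hN
  (hasExpect_empVar_sq (centeredMoments_uniformOn hN x) hn).2

lemma integral_resampleVar_subset (hN : 0 < N) (hn : 0 < n) (x : Fin N → ℝ) :
    ∫ k, resampleVar N (fun i => x (k i)) ∂(subsetLaw N n) =
      meanResampleVar N n (empFourth x) (empVar x ^ 2) := by
  have := isProbabilityMeasure_uniformOn_fin hN
  simp only [resampleVar, meanResampleVar]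
  rw [integral_div, integral_add .of_finite .of_finite, integral_const_mul,
    integral_empVar_sq_subset hN hn,
    (hasExpect_empFourth (centeredMoments_uniformOn hN x) hn).2]

/-- The joint law of all the index draws. -/
abbrev drawLaw (N n R B : ℕ) :
    Measure ((Fin R → Fin n → Fin N) × (Fin R → Fin B → Fin N → Fin n)) :=
  (Measure.pi fun _ => subsetLaw N n).prod (Measure.pi fun _ => resampleLaw N n B)

lemma isProbabilityMeasure_drawLaw (hN : 0 < N) (hn : 0 < n) (R B : ℕ) :
    IsProbabilityMeasure (drawLaw N n R B) := by
  have := isProbabilityMeasure_resampleLaw N hn B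
  have := isProbabilityMeasure_subsetLaw hN n
  infer_instance

lemma integral_seSqC_draw (hN : 0 < N) (hn : 0 < n) (hR : 0 < R) (hB : 0 < B) (x : Fin N → ℝ) :
    ∫ p, seSqC x p.1 p.2 ∂(drawLaw N n R B) = (1 - 1 / n) / N * empVar x := by
  have := isProbabilityMeasure_resampleLaw N hn B
  have := isProbabilityMeasure_subsetLaw hN n
  have hR' : (R : ℝ) ≠ 0 := by positivity
  rw [integral_prod _ .of_finite]
  simp only [integral_seSqC_resample hN hn hB, subset_eq]
  rw [integral_div, integral_sum_eval (subsetLaw N n) fun _ k => empVar (fun i => x (k i)),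
    integral_empVar_subset hN hn]
  simp only [Finset.sum_const, Finset.card_univ, Fintype.card_fin, nsmul_eq_mul]
  field_simp

lemma integral_seSqC_sq_draw (hN : 0 < N) (hn : 0 < n) (hR : 0 < R) (hB : 0 < B)
    (x : Fin N → ℝ) :
    ∫ p, seSqC x p.1 p.2 ^ 2 ∂(drawLaw N n R B) =
      condSecondMoment N n R B (empFourth x) (empVar x ^ 2) := by
  have := isProbabilityMeasure_resampleLaw N hn B
  have := isProbabilityMeasure_subsetLaw hN n
  have hR' : (R : ℝ) ≠ 0 := by positivity
  rw [integral_prod _ .of_finite]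
  simp only [integral_seSqC_sq_resample hN hn hB, subset_eq]
  rw [integral_add .of_finite .of_finite, integral_const_mul, integral_const_mul,
    integral_sum_eval (subsetLaw N n) fun _ k => resampleVar N (fun i => x (k i)),
    integral_sum_eval_sq (subsetLaw N n) fun _ k => empVar (fun i => x (k i)),
    integral_empVar_subset hN hn, integral_empVar_sq_subset hN hn,
    integral_resampleVar_subset hN hn]
  simp only [Finset.sum_const, Finset.card_univ, Fintype.card_fin, nsmul_eq_mul, condSecondMoment]
  field_simp

end Conditional

section Unconditional

variable {N n R B : ℕ} {ν : Measure ℝ} [IsProbabilityMeasure ν]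

lemma law_eq (ν : Measure ℝ) (N n R B : ℕ) :
    law ν N n R B = (Measure.pi fun _ => ν).prod (drawLaw N n R B) := rfl

lemma measurable_mean (m : ℕ) : Measurable (mean : (Fin m → ℝ) → ℝ) := by
  unfold mean; fun_prop

lemma measurable_empVar (m : ℕ) : Measurable (empVar : (Fin m → ℝ) → ℝ) := by
  have := measurable_mean m
  unfold empVar; fun_prop

lemma measurable_seSqC (N n R B : ℕ) :
    Measurable fun p : (Fin N → ℝ) × (Fin R → Fin n → Fin N) × (Fin R → Fin B → Fin N → Fin n) =>
      seSqC p.1 p.2.1 p.2.2 := by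
  refine measurable_from_prod_countable_left fun q => ?_
  simp only [seSqC, mean, resample, subset]
  fun_prop

lemma abs_mean_le {m N : ℕ} (x : Fin N → ℝ) (k : Fin m → Fin N) :
    |mean (fun i => x (k i))| ≤ ∑ j, |x j| := by
  have h0 : 0 ≤ ∑ j, |x j| := Finset.sum_nonneg fun _ _ => abs_nonneg _
  rw [mean, abs_div, Nat.abs_cast]
  refine div_le_of_le_mul₀ (by positivity) h0 ?_
  calc |∑ i, x (k i)| ≤ ∑ i, |x (k i)| := Finset.abs_sum_le_sum_abs _ _
    _ ≤ ∑ _i : Fin m, ∑ j, |x j| := Finset.sum_le_sum fun i _ =>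
        Finset.single_le_sum (f := fun j => |x j|) (fun _ _ => abs_nonneg _) (Finset.mem_univ _)
    _ = (∑ j, |x j|) * m := by simp [mul_comm]

lemma abs_seSqC_le (x : Fin N → ℝ) (I : Fin R → Fin n → Fin N)
    (J : Fin R → Fin B → Fin N → Fin n) : |seSqC x I J| ≤ 4 * (∑ j, |x j|) ^ 2 := by
  set S := ∑ j, |x j| with hS
  have h : ∀ r b, (mean (resample x I J r b) - mean (subset x I r)) ^ 2 ≤ 4 * S ^ 2 := by
    intro r b
    have h1 := abs_le.1 (abs_mean_le x fun i => I r (J r b i))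
    have h2 := abs_le.1 (abs_mean_le x fun i => I r i)
    change (mean (fun i => x (I r (J r b i))) - mean (fun i => x (I r i))) ^ 2 ≤ 4 * S ^ 2
    rw [show 4 * S ^ 2 = (2 * S) ^ 2 by ring]
    exact sq_le_sq' (by linarith) (by linarith)
  have h0 : 0 ≤ seSqC x I J :=
    div_nonneg (Finset.sum_nonneg fun _ _ => Finset.sum_nonneg fun _ _ => sq_nonneg _)
      (by positivity)
  rw [abs_of_nonneg h0, seSqC]
  refine div_le_of_le_mul₀ (by positivity) (by positivity) ?_
  calc _ ≤ ∑ _r : Fin R, ∑ _b : Fin B, 4 * S ^ 2 :=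
        Finset.sum_le_sum fun r _ => Finset.sum_le_sum fun b _ => h r b
    _ = 4 * S ^ 2 * (B * R) := by simp; ring

lemma memLp_seSqC (hν : MemLp (fun x : ℝ => x) 4 ν) (hN : 0 < N) (hn : 0 < n) (R B : ℕ) :
    MemLp (fun p : (Fin N → ℝ) × (Fin R → Fin n → Fin N) × (Fin R → Fin B → Fin N → Fin n) =>
      seSqC p.1 p.2.1 p.2.2) 2 (law ν N n R B) := by
  have := isProbabilityMeasure_drawLaw hN hn R B
  have h4 : MemLp (fun x : Fin N → ℝ => ∑ j, |x j|) 4 (Measure.pi fun _ => ν) :=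
    memLp_finsetSum _ fun j _ =>
      (hν.comp_measurePreserving (measurePreserving_eval (fun _ : Fin N => ν) j)).norm
  have h2 : MemLp (fun x : Fin N → ℝ => 4 * (∑ j, |x j|) ^ 2) 2 (Measure.pi fun _ => ν) := by
    refine MemLp.const_mul ?_ 4
    refine (memLp_two_iff_integrable_sq (h4.1.pow 2)).2 ?_
    have := MemLp.integrable_norm_pow (p := 4) (by exact_mod_cast h4) (by norm_num)
    refine this.congr (ae_of_all _ fun x => ?_)
    simp only [Real.norm_eq_abs, Pi.pow_apply]
    rw [abs_of_nonneg (Finset.sum_nonneg fun _ _ => abs_nonneg _)]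
    ring
  rw [law_eq]
  refine (h2.comp_fst (drawLaw N n R B)).mono
    (measurable_seSqC N n R B).aestronglyMeasurable (ae_of_all _ fun p => ?_)
  rw [Real.norm_eq_abs, Real.norm_of_nonneg (by positivity)]
  exact abs_seSqC_le _ _ _

variable {μ a₂ a₃ a₄ : ℝ}

/-- The mean of the empirical fourth central moment of `N` observations. -/
def fourthMean (N : ℕ) (a₂ a₄ : ℝ) : ℝ := fourthW₄ N * a₄ + fourthW₂ N * a₂ ^ 2

/-- The second moment of the empirical variance of `N` observations. -/
def sqMean (N : ℕ) (a₂ a₄ : ℝ) : ℝ := sqW₄ N * a₄ + sqW₂ N * a₂ ^ 2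

lemma integral_seSqC (hν : MemLp (fun x : ℝ => x) 4 ν)
    (h : CenteredMoments ν (fun x => x - μ) a₂ a₃ a₄)
    (hN : 0 < N) (hn : 0 < n) (hR : 0 < R) (hB : 0 < B) :
    ∫ p, seSqC p.1 p.2.1 p.2.2 ∂(law ν N n R B) =
      a₂ / N * (1 - 1 / n) * (1 - 1 / N) := by
  have := isProbabilityMeasure_drawLaw hN hn R B
  have : IsProbabilityMeasure (law ν N n R B) := by rw [law_eq]; infer_instance
  have hi := (memLp_seSqC hν hN hn R B).integrable (by norm_num)
  rw [law_eq] at hi ⊢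
  rw [integral_prod _ hi]
  simp only [integral_seSqC_draw hN hn hR hB]
  rw [integral_const_mul, (hasExpect_empVar (f := fun x => x) h hN).2]
  ring

lemma integral_seSqC_sq (hν : MemLp (fun x : ℝ => x) 4 ν)
    (h : CenteredMoments ν (fun x => x - μ) a₂ a₃ a₄)
    (hN : 0 < N) (hn : 0 < n) (hR : 0 < R) (hB : 0 < B) :
    ∫ p, seSqC p.1 p.2.1 p.2.2 ^ 2 ∂(law ν N n R B) =
      condSecondMoment N n R B (fourthMean N a₂ a₄) (sqMean N a₂ a₄) := by
  have := isProbabilityMeasure_drawLaw hN hn R B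
  have hi := (memLp_seSqC hν hN hn R B).integrable_sq
  rw [law_eq] at hi ⊢
  rw [integral_prod _ hi]
  simp only [integral_seSqC_sq_draw hN hn hR hB]
  have h4 := hasExpect_empFourth (f := fun x => x) h hN
  have h2 := hasExpect_empVar_sq (f := fun x => x) h hN
  have hlin : ∀ M V : ℝ, condSecondMoment N n R B M V =
      condSecondMoment N n R B 1 0 * M + condSecondMoment N n R B 0 1 * V := by
    intro M V
    simp only [condSecondMoment, meanResampleVar]
    ring
  rw [hlin (fourthMean N a₂ a₄), funext fun x : Fin N → ℝ => hlin (empFourth x) (empVar x ^ 2)]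
  exact ((h4.const_mul _).add (h2.const_mul _)).2

lemma variance_seSqC (hν : MemLp (fun x : ℝ => x) 4 ν)
    (h : CenteredMoments ν (fun x => x - μ) a₂ a₃ a₄)
    (hN : 0 < N) (hn : 0 < n) (hR : 0 < R) (hB : 0 < B) :
    Var[fun p => seSqC p.1 p.2.1 p.2.2; law ν N n R B] =
      condSecondMoment N n R B (fourthMean N a₂ a₄) (sqMean N a₂ a₄) -
        (a₂ / N * (1 - 1 / n) * (1 - 1 / N)) ^ 2 := by
  have := isProbabilityMeasure_drawLaw hN hn R B
  have : IsProbabilityMeasure (law ν N n R B) := by rw [law_eq]; infer_instance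
  rw [variance_eq_sub (memLp_seSqC hν hN hn R B), integral_seSqC hν h hN hn hR hB]
  congr 1
  exact integral_seSqC_sq hν h hN hn hR hB

lemma memLp_seSqA (h : CenteredMoments ν (fun x => x - μ) a₂ a₃ a₄) (hN : 0 < N) :
    MemLp (seSqA : (Fin N → ℝ) → ℝ) 2 (Measure.pi fun _ => ν) := by
  have : MemLp (empVar : (Fin N → ℝ) → ℝ) 2 (Measure.pi fun _ => ν) :=
    (memLp_two_iff_integrable_sq (measurable_empVar N).aestronglyMeasurable).2
      (hasExpect_empVar_sq (f := fun x => x) h hN).1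
  refine (this.const_mul (N : ℝ)⁻¹).ae_eq (ae_of_all _ fun x => ?_)
  simp [seSqA]; ring

lemma variance_seSqA (h : CenteredMoments ν (fun x => x - μ) a₂ a₃ a₄) (hN : 0 < N) :
    Var[seSqA; Measure.pi fun _ : Fin N => ν] =
      (sqMean N a₂ a₄ - ((1 - 1 / N) * a₂) ^ 2) / N ^ 2 := by
  rw [variance_eq_sub (memLp_seSqA h hN)]
  have h1 := (hasExpect_empVar (f := fun x => x) h hN).2
  have h2 := (hasExpect_empVar_sq (f := fun x => x) h hN).2
  simp only [Pi.pow_apply, seSqA, div_pow]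
  rw [integral_div, integral_div, h1, h2, sqMean]
  ring

lemma memLp_mean (h : CenteredMoments ν (fun x => x - μ) a₂ a₃ a₄) (hN : 0 < N) :
    MemLp (mean : (Fin N → ℝ) → ℝ) 2 (Measure.pi fun _ => ν) := by
  have : MemLp (fun x : Fin N → ℝ => mean x - μ) 2 (Measure.pi fun _ => ν) :=
    (memLp_two_iff_integrable_sq ((measurable_mean N).sub_const μ).aestronglyMeasurable).2
      (hasExpect_mean_sub_sq (f := fun x => x) h hN).1
  refine (this.add (memLp_const μ)).ae_eq (ae_of_all _ fun x => ?_)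
  simp

lemma variance_mean (h : CenteredMoments ν (fun x => x - μ) a₂ a₃ a₄) (hN : 0 < N) :
    Var[mean; Measure.pi fun _ : Fin N => ν] = a₂ / N := by
  have h1 := (hasExpect_mean_sub (f := fun x => x) h hN).2
  have h2 := (hasExpect_mean_sub_sq (f := fun x => x) h hN).2
  rw [integral_sub ((memLp_mean h hN).integrable (by norm_num)) (integrable_const μ)] at h1
  simp only [integral_const, probReal_univ, smul_eq_mul, one_mul] at h1
  rw [variance_eq_integral (measurable_mean N).aemeasurable, ← h2]
  rw [show ∫ x, mean x ∂(Measure.pi fun _ : Fin N => ν) = μ by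
    rw [← sub_eq_zero]; exact h1]

end Unconditional

section ExactVariance

variable {N n R B : ℕ}

/-- `fourthMean` as a polynomial in the reciprocal `w` of the sample size. -/
def fourthPoly (a₂ a₄ w : ℝ) : ℝ :=
  (1 - 4 * w + 6 * w ^ 2 - 3 * w ^ 3) * a₄ + (6 * (w - w ^ 2) - 9 * (w ^ 2 - w ^ 3)) * a₂ ^ 2

/-- `sqMean` as a polynomial in the reciprocal `w` of the sample size. -/
def sqPoly (a₂ a₄ w : ℝ) : ℝ :=
  w * (1 - w) ^ 2 * a₄ + (1 - w) * (1 - 2 * w + 3 * w ^ 2) * a₂ ^ 2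

/-- The variance of the empirical variance, multiplied by the sample size, as a polynomial in the
reciprocal `w` of the sample size. -/
def analyticCoeff (a₂ a₄ w : ℝ) : ℝ := (1 - w) ^ 2 * a₄ + (1 - w) * (3 * w - 1) * a₂ ^ 2

/-- The coefficient of `1 / (R B)` in the variance of the estimator, with `u = 1 / n` and
`w = 1 / N`. -/
def resampleCoeff (a₂ a₄ u w : ℝ) : ℝ :=
  w * ((1 - 4 * u + 6 * u ^ 2 - 3 * u ^ 3) * fourthPoly a₂ a₄ w +
      (6 * (u - u ^ 2) - 9 * (u ^ 2 - u ^ 3)) * sqPoly a₂ a₄ w) +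
    (2 - 3 * w) * (u * (1 - u) ^ 2 * fourthPoly a₂ a₄ w +
      (1 - u) * (1 - 2 * u + 3 * u ^ 2) * sqPoly a₂ a₄ w)

/-- The coefficient of `1 / (n R)` in the variance of the estimator, with `u = 1 / n` and
`w = 1 / N`. -/
def subsetCoeff (a₂ a₄ u w : ℝ) : ℝ :=
  (1 - u) ^ 2 * fourthPoly a₂ a₄ w + (1 - u) * (3 * u - 1) * sqPoly a₂ a₄ w

/-- The coefficient of `1 / N` in the variance of the estimator, with `u = 1 / n` and
`w = 1 / N`. -/
def dataCoeff (a₂ a₄ u w : ℝ) : ℝ := (1 - u) ^ 2 * analyticCoeff a₂ a₄ w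

/-- The part of the squared bias of the estimator that is of the order `1 / N`, relative to
`1 / N ^ 3`, with `u = 1 / n` and `w = 1 / N`. -/
def biasCoeff (a₂ u w : ℝ) : ℝ := a₂ ^ 2 * (2 * u * (1 - u) + (1 - u) ^ 2 * w)

lemma sqW₄_eq {m : ℕ} (hm : 0 < m) : sqW₄ m = 1 / (m : ℝ) * (1 - 1 / m) ^ 2 := by
  have : (m : ℝ) ≠ 0 := by positivity
  rw [sqW₄]; field_simp

lemma sqW₂_eq {m : ℕ} (hm : 0 < m) :
    sqW₂ m = (1 - 1 / (m : ℝ)) * (1 - 2 * (1 / m) + 3 * (1 / m) ^ 2) := by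
  have : (m : ℝ) ≠ 0 := by positivity
  rw [sqW₂]; field_simp

lemma fourthW₄_eq (m : ℕ) :
    fourthW₄ m = 1 - 4 * (1 / (m : ℝ)) + 6 * (1 / m) ^ 2 - 3 * (1 / m) ^ 3 := by
  rw [fourthW₄]; ring

lemma fourthW₂_eq {m : ℕ} (hm : 0 < m) :
    fourthW₂ m = 6 * (1 / (m : ℝ) - (1 / m) ^ 2) - 9 * ((1 / m) ^ 2 - (1 / m) ^ 3) := by
  have : (m : ℝ) ≠ 0 := by positivity
  rw [fourthW₂]; field_simp

lemma fourthMean_eq (hN : 0 < N) (a₂ a₄ : ℝ) : fourthMean N a₂ a₄ = fourthPoly a₂ a₄ (1 / N) := by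
  rw [fourthMean, fourthW₄_eq, fourthW₂_eq hN, fourthPoly]

lemma sqMean_eq (hN : 0 < N) (a₂ a₄ : ℝ) : sqMean N a₂ a₄ = sqPoly a₂ a₄ (1 / N) := by
  rw [sqMean, sqW₄_eq hN, sqW₂_eq hN, sqPoly]

lemma meanResampleVar_eq (hN : 0 < N) (hn : 0 < n) (a₂ a₄ : ℝ) :
    meanResampleVar N n (fourthPoly a₂ a₄ (1 / N)) (sqPoly a₂ a₄ (1 / N)) =
      resampleCoeff a₂ a₄ (1 / n) (1 / N) / N ^ 2 := by
  rw [meanResampleVar, resampleCoeff, sqW₄_eq hn, sqW₂_eq hn, fourthW₄_eq, fourthW₂_eq hn]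
  generalize fourthPoly a₂ a₄ (1 / N) = F
  generalize sqPoly a₂ a₄ (1 / N) = S
  generalize 1 / (n : ℝ) = u
  have : (N : ℝ) ≠ 0 := by positivity
  field_simp

lemma condSecondMoment_sub_sq (hN : 0 < N) (hn : 0 < n) (R B : ℕ) (a₂ a₄ : ℝ) :
    condSecondMoment N n R B (fourthMean N a₂ a₄) (sqMean N a₂ a₄) -
        (a₂ / N * (1 - 1 / n) * (1 - 1 / N)) ^ 2 =
      (resampleCoeff a₂ a₄ (1 / n) (1 / N) * (1 / (R * B)) +
        subsetCoeff a₂ a₄ (1 / n) (1 / N) * (1 / (n * R)) +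
        dataCoeff a₂ a₄ (1 / n) (1 / N) * (1 / N)) / N ^ 2 := by
  rw [fourthMean_eq hN, sqMean_eq hN, condSecondMoment, meanResampleVar_eq hN hn, subsetCoeff,
    dataCoeff, sqW₄_eq hn, sqW₂_eq hn]
  have h1 : analyticCoeff a₂ a₄ (1 / N) * (1 / N) =
      sqPoly a₂ a₄ (1 / N) - (1 - 1 / N) ^ 2 * a₂ ^ 2 := by
    rw [analyticCoeff, sqPoly]; ring
  rw [mul_assoc _ (analyticCoeff _ _ _) _, h1]
  generalize resampleCoeff a₂ a₄ (1 / n) (1 / N) = α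
  generalize fourthPoly a₂ a₄ (1 / N) = F
  generalize sqPoly a₂ a₄ (1 / N) = S
  ring

lemma sqMean_sub_sq (hN : 0 < N) (a₂ a₄ : ℝ) :
    (sqMean N a₂ a₄ - ((1 - 1 / N) * a₂) ^ 2) / N ^ 2 =
      analyticCoeff a₂ a₄ (1 / N) * (1 / N) / N ^ 2 := by
  rw [sqMean_eq hN, sqPoly, analyticCoeff]; ring

lemma sq_bias_eq (N n : ℕ) (a₂ : ℝ) :
    (a₂ / N * (1 - 1 / n) * (1 - 1 / N) - a₂ / N) ^ 2 =
      a₂ ^ 2 * (1 / n ^ 2) / N ^ 2 + biasCoeff a₂ (1 / n) (1 / N) * (1 / N) / N ^ 2 := by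
  rw [biasCoeff]; ring

end ExactVariance

section Asymptotic

variable {ι : Type*} {l : Filter ι} {a₂ a₄ : ℝ} {u w : ι → ℝ}

lemma tendsto_resampleCoeff (hu : Tendsto u l (𝓝 0)) (hw : Tendsto w l (𝓝 0)) (a₂ a₄ : ℝ) :
    Tendsto (fun k => resampleCoeff a₂ a₄ (u k) (w k)) l (𝓝 (2 * a₂ ^ 2)) := by
  have hc : Continuous fun p : ℝ × ℝ => resampleCoeff a₂ a₄ p.1 p.2 := by
    unfold resampleCoeff fourthPoly sqPoly; fun_prop
  have := (hc.tendsto (0, 0)).comp (hu.prodMk_nhds hw)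
  simpa [resampleCoeff, sqPoly, Function.comp_def] using this

lemma tendsto_subsetCoeff (hu : Tendsto u l (𝓝 0)) (hw : Tendsto w l (𝓝 0)) (a₂ a₄ : ℝ) :
    Tendsto (fun k => subsetCoeff a₂ a₄ (u k) (w k)) l (𝓝 (a₄ - a₂ ^ 2)) := by
  have hc : Continuous fun p : ℝ × ℝ => subsetCoeff a₂ a₄ p.1 p.2 := by
    unfold subsetCoeff fourthPoly sqPoly; fun_prop
  have := (hc.tendsto (0, 0)).comp (hu.prodMk_nhds hw)
  simpa [subsetCoeff, fourthPoly, sqPoly, Function.comp_def, sub_eq_add_neg] using this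

lemma tendsto_analyticCoeff (hw : Tendsto w l (𝓝 0)) (a₂ a₄ : ℝ) :
    Tendsto (fun k => analyticCoeff a₂ a₄ (w k)) l (𝓝 (a₄ - a₂ ^ 2)) := by
  have hc : Continuous fun p : ℝ => analyticCoeff a₂ a₄ p := by unfold analyticCoeff; fun_prop
  have := (hc.tendsto 0).comp hw
  simpa [analyticCoeff, Function.comp_def, sub_eq_add_neg] using this

lemma tendsto_dataCoeff (hu : Tendsto u l (𝓝 0)) (hw : Tendsto w l (𝓝 0)) (a₂ a₄ : ℝ) :
    Tendsto (fun k => dataCoeff a₂ a₄ (u k) (w k)) l (𝓝 (a₄ - a₂ ^ 2)) := by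
  simpa [dataCoeff] using ((hu.const_sub 1).pow 2).mul (tendsto_analyticCoeff hw a₂ a₄)

lemma tendsto_biasCoeff (hu : Tendsto u l (𝓝 0)) (hw : Tendsto w l (𝓝 0)) (a₂ : ℝ) :
    Tendsto (fun k => biasCoeff a₂ (u k) (w k)) l (𝓝 0) := by
  have hc : Continuous fun p : ℝ × ℝ => biasCoeff a₂ p.1 p.2 := by unfold biasCoeff; fun_prop
  have := (hc.tendsto (0, 0)).comp (hu.prodMk_nhds hw)
  simpa [biasCoeff, Function.comp_def] using this

lemma isEquivalent_mul_of_tendsto {α a : ι → ℝ} {A : ℝ} (hA : A ≠ 0) (h : Tendsto α l (𝓝 A)) :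
    (fun k => α k * a k) ~[l] (fun k => A * a k) :=
  ((isEquivalent_const_iff_tendsto hA).2 h).mul .refl

lemma isEquivalent_add_of_nonneg {f g f' g' : ι → ℝ} (hf : f ~[l] f') (hg : g ~[l] g')
    (hf' : ∀ k, 0 ≤ f' k) (hg' : ∀ k, 0 ≤ g' k) :
    (fun k => f k + g k) ~[l] (fun k => f' k + g' k) :=
  IsEquivalent.add_add_of_nonneg hf' hg' hf hg

lemma exists_eq_mul_one_add {f g : ι → ℝ} (h : f ~[l] g) :
    ∃ δ : ι → ℝ, Tendsto δ l (𝓝 0) ∧ ∀ᶠ k in l, f k = g k * (1 + δ k) := by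
  obtain ⟨φ, hφ, hfg⟩ := h.exists_eq_mul
  refine ⟨fun k => φ k - 1, by simpa using hφ.sub_const 1, hfg.mono fun k hk => ?_⟩
  rw [hk, Pi.mul_apply]; ring

end Asymptotic

section Moments

lemma sq_le_fourth_moment {ν : Measure ℝ} [IsProbabilityMeasure ν] {μ a₂ a₃ a₄ : ℝ}
    (h : CenteredMoments ν (fun x => x - μ) a₂ a₃ a₄) : a₂ ^ 2 ≤ a₄ := by
  have h1 : HasExpect ν (fun x => ((x - μ) ^ 2 - a₂) ^ 2) (a₄ - a₂ ^ 2) :=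
    (h.four.add ((h.two.const_mul (-2 * a₂)).add (hasExpect_const (a₂ ^ 2)))).congr
      (fun x => by ring) (by ring)
  have h2 : 0 ≤ a₄ - a₂ ^ 2 := h1.2 ▸ integral_nonneg fun x => sq_nonneg _
  linarith

lemma fourth_moment_eq_zero {ν : Measure ℝ} {μ a₃ a₄ : ℝ}
    (h : CenteredMoments ν (fun x => x - μ) 0 a₃ a₄) : a₄ = 0 := by
  have h1 := (integral_eq_zero_iff_of_nonneg (fun x => sq_nonneg (x - μ)) h.two.1).1 h.two.2
  rw [← h.four.2]
  refine integral_eq_zero_of_ae (h1.mono fun x hx => ?_)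
  have hx' : x - μ = 0 := by simpa using hx
  simp [hx']

lemma mse_eq {Ω : Type*} [MeasurableSpace Ω] {P : Measure Ω} [IsProbabilityMeasure P] {T : Ω → ℝ}
    (hT : MemLp T 2 P) (θ : ℝ) : mse P T θ = Var[T; P] + (∫ ω, T ω ∂P - θ) ^ 2 := by
  have h := variance_eq_sub (hT.sub (memLp_const θ))
  have h1 : ∫ ω, (T - fun _ => θ : Ω → ℝ) ω ∂P = ∫ ω, T ω ∂P - θ := by
    simp only [Pi.sub_apply]
    rw [integral_sub (hT.integrable (by norm_num)) (integrable_const θ)]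
    simp
  have h2 : Var[(T - fun _ => θ : Ω → ℝ); P] = Var[T; P] := variance_sub_const hT.1 θ
  rw [h1, h2] at h
  rw [h, mse]
  simp

lemma memLp_comp_of_hasLaw {Ω 𝓧 : Type*} [MeasurableSpace Ω] [MeasurableSpace 𝓧]
    {P : Measure Ω} {Q : Measure 𝓧} {X : Ω → 𝓧} (hX : HasLaw X Q P) {f : 𝓧 → ℝ}
    {p : ENNReal} (hf : MemLp f p Q) : MemLp (fun ω => f (X ω)) p P := by
  rw [← hX.map_eq] at hf
  exact (memLp_map_measure_iff hf.1 hX.aemeasurable).1 hf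

lemma variance_comp_of_hasLaw {Ω 𝓧 : Type*} [MeasurableSpace Ω] [MeasurableSpace 𝓧]
    {P : Measure Ω} {Q : Measure 𝓧} {X : Ω → 𝓧} (hX : HasLaw X Q P) {f : 𝓧 → ℝ}
    (hf : AEMeasurable f Q) : Var[fun ω => f (X ω); P] = Var[f; Q] := by
  rw [← hX.map_eq, variance_map (hX.map_eq ▸ hf) hX.aemeasurable, Function.comp_def]

end Moments

end BLB

end

theorem theorem3
    {ι : Type*} {l : Filter ι}
    -- the sample size, subset size, number of subsets, resamples per subset
    (N n R B : ι → ℕ)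
    (hN0 : ∀ k, 0 < N k) (hn0 : ∀ k, 0 < n k) (hR0 : ∀ k, 0 < R k) (hB0 : ∀ k, 0 < B k)
    (hN : Tendsto N l atTop)
    -- the common law of the observations, with its moments
    (ν : Measure ℝ) [IsProbabilityMeasure ν] (hν : MemLp (fun x : ℝ => x) 4 ν)
    (μ σ σ₄ : ℝ) (hμ : μ = ∫ x, x ∂ν) (hσ : σ ^ 2 = ∫ x, (x - μ) ^ 2 ∂ν)
    (hσ₄ : σ₄ = ∫ x, (x - μ) ^ 4 ∂ν)
    -- the data and the index draws of the two sampling stages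
    {Ω : ι → Type*} [∀ k, MeasurableSpace (Ω k)]
    (P : ∀ k, Measure (Ω k)) [∀ k, IsProbabilityMeasure (P k)]
    (X : ∀ k, Ω k → Fin (N k) → ℝ)
    (I : ∀ k, Ω k → Fin (R k) → Fin (n k) → Fin (N k))
    (J : ∀ k, Ω k → Fin (R k) → Fin (B k) → Fin (N k) → Fin (n k))
    (hlaw : ∀ k, HasLaw (fun ω => (X k ω, I k ω, J k ω))
      (BLB.law ν (N k) (n k) (R k) (B k)) (P k))
    -- the two estimators and the estimated squared standard error of the sample mean
    (SA SC : ∀ k, Ω k → ℝ) (θ : ι → ℝ)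
    (hSA : ∀ k ω, SA k ω = BLB.seSqA (X k ω))
    (hSC : ∀ k ω, SC k ω = BLB.seSqC (X k ω) (I k ω) (J k ω))
    (hθ : ∀ k, θ k = Var[fun ω => BLB.mean (X k ω); P k]) :
    -- all the moments below are finite
    (∀ k, MemLp (fun ω => BLB.mean (X k ω)) 2 (P k) ∧ MemLp (SA k) 2 (P k) ∧
      MemLp (SC k) 2 (P k)) ∧
    -- mean
    (fun k => ∫ ω, SC k ω ∂(P k)) ~[l] (fun k => σ ^ 2 / N k * (1 - 1 / (n k : ℝ))) ∧
    (Tendsto n l atTop → σ₄ - σ ^ 4 ≠ 0 →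
      -- variance
      ((fun k => Var[SC k; P k]) ~[l]
        (fun k => Var[SA k; P k] *
          (2 * σ ^ 4 / (σ₄ - σ ^ 4) * ((N k : ℝ) / (R k * B k)) + (N k : ℝ) / (n k * R k) + 1))) ∧
      -- mean squared error, in terms of the variance of the analytic-formula estimator
      (∃ δ : ι → ℝ, Tendsto δ l (𝓝 0) ∧ ∀ᶠ k in l,
        BLB.mse (P k) (SC k) (θ k) =
          Var[SA k; P k] *
            (2 * σ ^ 4 / (σ₄ - σ ^ 4) * ((N k : ℝ) / (R k * B k)) + (N k : ℝ) / (n k * R k) + 1) *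
            (1 + δ k) + σ ^ 4 / ((N k : ℝ) ^ 2 * (n k : ℝ) ^ 2)) ∧
      -- mean squared error, explicitly
      (∃ δ δ' : ι → ℝ, Tendsto δ l (𝓝 0) ∧ Tendsto δ' l (𝓝 0) ∧ ∀ᶠ k in l,
        BLB.mse (P k) (SC k) (θ k) =
          (σ₄ - σ ^ 4) / (N k : ℝ) ^ 2 *
            (2 * σ ^ 4 / (σ₄ - σ ^ 4) * (1 / ((R k : ℝ) * B k)) + 1 / ((n k : ℝ) * R k) +
              σ ^ 4 / (σ₄ - σ ^ 4) * (1 / (n k : ℝ) ^ 2)) * (1 + δ k) +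
          (σ₄ - σ ^ 4) / (N k : ℝ) ^ 3 * (1 + δ' k))) := by
  have hN0' : ∀ k, (0 : ℝ) < N k := fun k => by exact_mod_cast hN0 k
  have hn0' : ∀ k, (0 : ℝ) < n k := fun k => by exact_mod_cast hn0 k
  have hR0' : ∀ k, (0 : ℝ) < R k := fun k => by exact_mod_cast hR0 k
  have hB0' : ∀ k, (0 : ℝ) < B k := fun k => by exact_mod_cast hB0 k
  have hm := BLB.centeredMoments_of_memLp hν hμ hσ hσ₄
  have hw : Tendsto (fun k => 1 / (N k : ℝ)) l (𝓝 0) :=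
    tendsto_one_div_atTop_nhds_zero_nat.comp hN
  have hX : ∀ k, HasLaw (X k) (Measure.pi fun _ => ν) (P k) := fun k => by
    have := BLB.isProbabilityMeasure_drawLaw (hN0 k) (hn0 k) (R k) (B k)
    have h := hlaw k
    rw [BLB.law_eq] at h
    exact measurePreserving_fst.fun_comp_hasLaw h
  have hSA' : ∀ k, SA k = fun ω => BLB.seSqA (X k ω) := fun k => funext (hSA k)
  have hSC' : ∀ k, SC k = fun ω => BLB.seSqC (X k ω) (I k ω) (J k ω) := fun k => funext (hSC k)
  have hC := fun k => BLB.memLp_seSqC hν (hN0 k) (hn0 k) (R k) (B k)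
  have hCL : ∀ k, MemLp (SC k) 2 (P k) := fun k => by
    rw [hSC' k]; exact BLB.memLp_comp_of_hasLaw (hlaw k) (hC k)
  have hmean : ∀ k, ∫ ω, SC k ω ∂(P k) =
      σ ^ 2 / N k * (1 - 1 / (n k : ℝ)) * (1 - 1 / N k) := fun k => by
    rw [hSC' k, ← BLB.integral_seSqC hν hm (hN0 k) (hn0 k) (hR0 k) (hB0 k)]
    exact (hlaw k).integral_comp (hC k).1
  have hVC : ∀ k, Var[SC k; P k] =
      (BLB.resampleCoeff (σ ^ 2) σ₄ (1 / n k) (1 / N k) * (1 / (R k * B k)) +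
        BLB.subsetCoeff (σ ^ 2) σ₄ (1 / n k) (1 / N k) * (1 / (n k * R k)) +
        BLB.dataCoeff (σ ^ 2) σ₄ (1 / n k) (1 / N k) * (1 / N k)) / (N k : ℝ) ^ 2 := fun k => by
    rw [hSC' k]
    exact (BLB.variance_comp_of_hasLaw (hlaw k) (hC k).1.aemeasurable).trans <|
      (BLB.variance_seSqC hν hm (hN0 k) (hn0 k) (hR0 k) (hB0 k)).trans <|
      BLB.condSecondMoment_sub_sq (hN0 k) (hn0 k) (R k) (B k) _ _
  have hVA : ∀ k, Var[SA k; P k] =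
      BLB.analyticCoeff (σ ^ 2) σ₄ (1 / N k) * (1 / N k) / (N k : ℝ) ^ 2 := fun k => by
    rw [hSA' k, BLB.variance_comp_of_hasLaw (hX k) (BLB.memLp_seSqA hm (hN0 k)).1.aemeasurable,
      BLB.variance_seSqA hm (hN0 k), BLB.sqMean_sub_sq (hN0 k)]
  have hθ' : ∀ k, θ k = σ ^ 2 / N k := fun k => by
    rw [hθ k, BLB.variance_comp_of_hasLaw (hX k) (BLB.measurable_mean _).aemeasurable,
      BLB.variance_mean hm (hN0 k)]
  have hmse : ∀ k, BLB.mse (P k) (SC k) (θ k) = _ := fun k => by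
    rw [BLB.mse_eq (hCL k), hmean k, hθ' k, BLB.sq_bias_eq, hVC k]
  refine ⟨fun k => ⟨BLB.memLp_comp_of_hasLaw (hX k) (BLB.memLp_mean hm (hN0 k)), ?_, hCL k⟩, ?_, ?_⟩
  · rw [hSA' k]; exact BLB.memLp_comp_of_hasLaw (hX k) (BLB.memLp_seSqA hm (hN0 k))
  · simp only [hmean]
    have h1 : Tendsto (fun k => 1 - 1 / (N k : ℝ)) l (𝓝 1) := by simpa using hw.const_sub 1
    have := BLB.isEquivalent_mul_of_tendsto
      (a := fun k => σ ^ 2 / N k * (1 - 1 / (n k : ℝ))) one_ne_zero h1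
    simpa only [one_mul, mul_comm (1 - 1 / ((N _ : ℕ) : ℝ))] using this
  intro hn hD
  have hu : Tendsto (fun k => 1 / (n k : ℝ)) l (𝓝 0) :=
    tendsto_one_div_atTop_nhds_zero_nat.comp hn
  have hsq : (σ ^ 2) ^ 2 = σ ^ 4 := by ring
  have hDpos : 0 < σ₄ - σ ^ 4 := by
    have := BLB.sq_le_fourth_moment hm
    rw [hsq] at this
    exact lt_of_le_of_ne (by linarith) hD.symm
  have hσ0 : σ ≠ 0 := by
    rintro rfl
    have hm0 := hm
    rw [zero_pow two_ne_zero] at hm0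
    exact hD (by rw [BLB.fourth_moment_eq_zero hm0]; norm_num)
  have hσpos : 0 < σ ^ 4 := by positivity
  have hα := BLB.tendsto_resampleCoeff hu hw (σ ^ 2) σ₄
  have hβ := BLB.tendsto_subsetCoeff hu hw (σ ^ 2) σ₄
  have hγ := BLB.tendsto_dataCoeff hu hw (σ ^ 2) σ₄
  have hγA := BLB.tendsto_analyticCoeff hw (σ ^ 2) σ₄
  have hγB : Tendsto (fun k => BLB.dataCoeff (σ ^ 2) σ₄ (1 / n k) (1 / N k) +
      BLB.biasCoeff (σ ^ 2) (1 / n k) (1 / N k)) l (𝓝 (σ₄ - (σ ^ 2) ^ 2)) := by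
    simpa using hγ.add (BLB.tendsto_biasCoeff hu hw (σ ^ 2))
  simp only [hsq] at hα hβ hγ hγA hγB
  have hαβ := BLB.isEquivalent_add_of_nonneg
    (BLB.isEquivalent_mul_of_tendsto (a := fun k => 1 / ((R k : ℝ) * B k)) (by positivity) hα)
    (BLB.isEquivalent_mul_of_tendsto (a := fun k => 1 / ((n k : ℝ) * R k)) hD hβ)
    (fun k => by positivity) (fun k => by positivity)
  have htotal : ∀ {γ : ι → ℝ}, Tendsto γ l (𝓝 (σ₄ - σ ^ 4)) →
      (fun k => (BLB.resampleCoeff (σ ^ 2) σ₄ (1 / n k) (1 / N k) * (1 / (R k * B k)) +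
        BLB.subsetCoeff (σ ^ 2) σ₄ (1 / n k) (1 / N k) * (1 / (n k * R k)) +
        γ k * (1 / N k)) / (N k : ℝ) ^ 2) ~[l]
      (fun k => Var[SA k; P k] *
          (2 * σ ^ 4 / (σ₄ - σ ^ 4) * ((N k : ℝ) / (R k * B k)) +
            (N k : ℝ) / (n k * R k) + 1)) := by
    intro γ hγ'
    have h1 := (BLB.isEquivalent_add_of_nonneg hαβ
      (BLB.isEquivalent_mul_of_tendsto (a := fun k => 1 / (N k : ℝ)) hD hγ')
      (fun k => by positivity) (fun k => by positivity)).div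
      (IsEquivalent.refl (u := fun k => (N k : ℝ) ^ 2))
    refine h1.trans ?_
    have h2 := BLB.isEquivalent_mul_of_tendsto
      (a := fun k => 1 / (N k : ℝ) / (N k : ℝ) ^ 2 * (2 * σ ^ 4 / (σ₄ - σ ^ 4) *
        ((N k : ℝ) / (R k * B k)) + (N k : ℝ) / (n k * R k) + 1)) hD hγA
    refine (h2.congr_left (.of_eq (funext fun k => ?_))).symm.congr_left
      (.of_eq (funext fun k => ?_))
    · rw [hVA k]; ring
    · have := (hN0' k).ne'
      have := (hn0' k).ne'
      have := (hR0' k).ne'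
      have := (hB0' k).ne'
      simp only [Pi.div_apply]
      field_simp
  refine ⟨?_, ?_, ?_⟩
  · simp only [hVC]
    exact htotal hγ
  · obtain ⟨δ, hδ, h⟩ := BLB.exists_eq_mul_one_add (htotal hγB)
    refine ⟨δ, hδ, h.mono fun k hk => ?_⟩
    rw [← hk, hmse k]
    ring
  · have h1 := (BLB.isEquivalent_add_of_nonneg hαβ
      (IsEquivalent.refl (u := fun k => σ ^ 4 * (1 / (n k : ℝ) ^ 2)))
      (fun k => by positivity) (fun k => by positivity)).div
      (IsEquivalent.refl (u := fun k => (N k : ℝ) ^ 2))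
    have h2 := BLB.isEquivalent_mul_of_tendsto (a := fun k => 1 / (N k : ℝ) / (N k : ℝ) ^ 2) hD hγB
    obtain ⟨δ, hδ, h⟩ := BLB.exists_eq_mul_one_add h1
    obtain ⟨δ', hδ', h'⟩ := BLB.exists_eq_mul_one_add h2
    refine ⟨δ, δ', hδ, hδ', (h.and h').mono fun k hk => ?_⟩
    have h3 : (σ₄ - σ ^ 4) / (N k : ℝ) ^ 2 *
        (2 * σ ^ 4 / (σ₄ - σ ^ 4) * (1 / ((R k : ℝ) * B k)) + 1 / ((n k : ℝ) * R k) +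
          σ ^ 4 / (σ₄ - σ ^ 4) * (1 / (n k : ℝ) ^ 2)) =
        (2 * σ ^ 4 * (1 / ((R k : ℝ) * B k)) + (σ₄ - σ ^ 4) * (1 / ((n k : ℝ) * R k)) +
          σ ^ 4 * (1 / (n k : ℝ) ^ 2)) / (N k : ℝ) ^ 2 := by
      field_simp
    have h4 : (σ₄ - σ ^ 4) / (N k : ℝ) ^ 3 = (σ₄ - σ ^ 4) * (1 / (N k : ℝ) / (N k : ℝ) ^ 2) := by
      have := (hN0' k).ne'
      field_simp
    have h5 := hk.1
    simp only [Pi.div_apply] at h5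
    rw [h3, h4, ← h5, ← hk.2, hmse k]
    ring
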